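/- Let $d\ge 2$ be an integer. A qudit is a unit vector in $\mathbb{C}^d$, and a $2$-qudit gate is a unitary operator $V$ on $\mathbb{C}^d\otimes\mathbb{C}^d$; the $2$-qudit gates form the compact group $U(d^2)$ with its usual topology. A $2$-qudit gate $V$ is called primitive if for all qudits $x,y$ there are qudits $u,v$ such that $V(x\otimes y)=u\otimes v$, and imprimitive if it is not primitive. Then almost every $2$-qudit gate, with respect to Haar measure on $U(d^2)$, is imprimitive. Moreover, the set of imprimitive gates is a (nonempty) connected, open and dense subset of $U(d^2)$. -/

import Mathlib

/-- A qudit: a normalized state in the Hilbert space `ℂ^d`. -/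
def IsQudit {d : ℕ} (x : EuclideanSpace ℂ (Fin d)) : Prop := ‖x‖ = 1

/-- The tensor product `|xy⟩ = |x⟩ ⊗ |y⟩` in `ℂ^d ⊗ ℂ^d`. The latter space is written in its
computational basis `|ij⟩`, indexed by `Fin d × Fin d`, which is orthonormal; the coefficient of
`|x⟩ ⊗ |y⟩` at `|ij⟩` is `x i * y j`. -/
def tensorKet {d : ℕ} (x y : EuclideanSpace ℂ (Fin d)) :
    EuclideanSpace ℂ (Fin d × Fin d) :=
  WithLp.toLp 2 fun p => x p.1 * y p.2

/-- The 2-qudit gates: the unitary operators on `ℂ^d ⊗ ℂ^d`, given by their matrices in the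
computational basis. They form the compact group `U(d²)`, with its usual topology (that of the
matrix entries). -/
abbrev TwoQuditGate (d : ℕ) : Type := Matrix.unitaryGroup (Fin d × Fin d) ℂ

/-- The operator on `ℂ^d ⊗ ℂ^d` given by a gate, applied to a vector. -/
def TwoQuditGate.act {d : ℕ} (V : TwoQuditGate d) (ψ : EuclideanSpace ℂ (Fin d × Fin d)) :
    EuclideanSpace ℂ (Fin d × Fin d) :=
  WithLp.toLp 2 (Matrix.mulVec (V : Matrix (Fin d × Fin d) (Fin d × Fin d) ℂ) (WithLp.ofLp ψ))

/-- A 2-qudit gate is primitive if it maps decomposables to decomposables. -/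
def IsPrimitiveGate {d : ℕ} (V : TwoQuditGate d) : Prop :=
  ∀ x y : EuclideanSpace ℂ (Fin d), IsQudit x → IsQudit y →
    ∃ u v : EuclideanSpace ℂ (Fin d), IsQudit u ∧ IsQudit v ∧
      TwoQuditGate.act V (tensorKet x y) = tensorKet u v

/-- A 2-qudit gate is imprimitive if it is not primitive. -/
def IsImprimitiveGate {d : ℕ} (V : TwoQuditGate d) : Prop := ¬ IsPrimitiveGate V

/-! Primitive gates form a submonoid of $U(d^2)$, closed because the product states of qudits form a
compact set. A gate is imprimitive as soon as a certain 2×2 minor `q` of one of its columns is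
nonzero. In the space of all matrices, the locus `det * q ≠ 0` is connected and dense: a complex
line through one of its points leaves it at finitely many points only, and the plane minus a finite
set is connected and dense. Gram-Schmidt, started at that column, carries this locus continuously
onto the gates with `q ≠ 0`, since it rescales the column and `q` is homogeneous. Any set containing
a connected dense set is itself connected and dense, hence so is the set of imprimitive gates. For
the measure, a closed submonoid of a compact group is a subgroup; with positive Haar measure it
would contain a neighbourhood of 1, which its dense complement forbids. -/

/-! ### Nonvanishing loci of functions polynomial along lines -/

open Polynomial in
/-- A function that is polynomial along every complex line has a connected and dense
nonvanishing locus, as soon as the latter is nonempty. -/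
theorem isConnected_and_dense_ne_zero_of_polynomial_on_lines {E : Type*} [AddCommGroup E]
    [Module ℂ E] [TopologicalSpace E] [ContinuousAdd E] [ContinuousSMul ℂ E] {F : E → ℂ}
    (hF : ∀ a b : E, ∃ p : ℂ[X], ∀ z : ℂ, F (a + z • b) = p.eval z) (hne : ∃ a, F a ≠ 0) :
    IsConnected {a | F a ≠ 0} ∧ Dense {a | F a ≠ 0} := by
  have hcont : ∀ a b : E, Continuous fun z : ℂ => a + z • b := fun a b => by fun_prop
  have hrank : 1 < Module.rank ℝ ℂ := by
    rw [Complex.rank_real_complex]; exact Cardinal.one_lt_two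
  have key : ∀ p : ℂ[X], p ≠ 0 → IsConnected {z : ℂ | p.eval z ≠ 0} ∧
      Dense {z : ℂ | p.eval z ≠ 0} := by
    intro p hp
    have hfin : {z : ℂ | p.eval z = 0}.Finite := by
      refine p.roots.toFinset.finite_toSet.subset fun z hz => ?_
      simpa [hp] using hz
    exact ⟨hfin.countable.isConnected_compl_of_one_lt_rank hrank,
      hfin.countable.dense_compl ℝ⟩
  refine ⟨⟨hne, isPreconnected_of_forall_pair fun a ha b hb => ?_⟩, fun a => ?_⟩
  · obtain ⟨p, hp⟩ := hF a (b - a)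
    have h0 : p.eval 0 ≠ 0 := by rw [← hp]; simpa using ha
    have h1 : p.eval 1 ≠ 0 := by rw [← hp]; simpa using hb
    -- The complex line through `a` and `b`, minus the roots of `p`, joins them.
    refine ⟨(fun z : ℂ => a + z • (b - a)) '' {z | p.eval z ≠ 0}, ?_, ⟨0, h0, by simp⟩,
      ⟨1, h1, by simp⟩, ?_⟩
    · rintro _ ⟨z, hz, rfl⟩
      simpa [hp] using hz
    · exact (key p (by rintro rfl; simp at h0)).1.isPreconnected.image _
        (hcont a (b - a)).continuousOn
  · obtain ⟨b, hb⟩ := hne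
    obtain ⟨p, hp⟩ := hF a (b - a)
    have h1 : p.eval 1 ≠ 0 := by rw [← hp]; simpa using hb
    have hmem := image_closure_subset_closure_image (hcont a (b - a))
      ⟨0, (key p (by rintro rfl; simp at h1)).2 0, rfl⟩
    simp only [zero_smul, add_zero] at hmem
    refine closure_mono ?_ hmem
    rintro _ ⟨z, hz, rfl⟩
    simpa [hp] using hz

/-- If two functions are polynomial along every complex line and neither vanishes identically,
then their product does not vanish identically. -/
theorem exists_mul_ne_zero_of_polynomial_on_lines {E : Type*} [AddCommGroup E] [Module ℂ E]
    {F G : E → ℂ} (hF : ∀ a b : E, ∃ p : Polynomial ℂ, ∀ z : ℂ, F (a + z • b) = p.eval z)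
    (hG : ∀ a b : E, ∃ p : Polynomial ℂ, ∀ z : ℂ, G (a + z • b) = p.eval z)
    (hF0 : ∃ a, F a ≠ 0) (hG0 : ∃ a, G a ≠ 0) : ∃ a, F a * G a ≠ 0 := by
  obtain ⟨a, ha⟩ := hF0
  obtain ⟨b, hb⟩ := hG0
  obtain ⟨p, hp⟩ := hF a (b - a)
  obtain ⟨r, hr⟩ := hG a (b - a)
  have h0 : p.eval 0 ≠ 0 := by rw [← hp]; simpa using ha
  have h1 : r.eval 1 ≠ 0 := by rw [← hr]; simpa using hb
  have hpr : p * r ≠ 0 := mul_ne_zero (by rintro rfl; simp at h0) (by rintro rfl; simp at h1)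
  by_contra! h
  refine hpr (Polynomial.funext fun z => ?_)
  rw [Polynomial.eval_mul, ← hp, ← hr, h, Polynomial.eval_zero]

theorem Matrix.exists_polynomial_det_add_smul {n : Type*} [Fintype n] [DecidableEq n]
    (A B : Matrix n n ℂ) : ∃ p : Polynomial ℂ, ∀ z : ℂ, (A + z • B).det = p.eval z := by
  refine ⟨(A.map Polynomial.C + (Polynomial.X : Polynomial ℂ) • B.map Polynomial.C).det,
    fun z => ?_⟩
  rw [← Polynomial.coe_evalRingHom, RingHom.map_det]
  congr 1
  ext i j
  simp [mul_comm z]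

/-! ### Gram-Schmidt as a retraction onto the unitary group -/

theorem continuousOn_gramSchmidt {ι E : Type*} [LinearOrder ι] [LocallyFiniteOrderBot ι]
    [WellFoundedLT ι] [NormedAddCommGroup E] [InnerProductSpace ℂ E] (i : ι) :
    ContinuousOn (fun f : ι → E => InnerProductSpace.gramSchmidt ℂ f i)
      {f | LinearIndependent ℂ f} := by
  induction i using WellFoundedLT.induction with
  | ind i ih =>
    have hformula : (fun f : ι → E => InnerProductSpace.gramSchmidt ℂ f i) = fun f =>
        f i - ∑ j ∈ Finset.Iio i, (inner ℂ (InnerProductSpace.gramSchmidt ℂ f j) (f i) /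
          (‖InnerProductSpace.gramSchmidt ℂ f j‖ : ℂ) ^ 2) •
            InnerProductSpace.gramSchmidt ℂ f j := by
      funext f
      exact eq_sub_of_add_eq (InnerProductSpace.gramSchmidt_def'' ℂ f i).symm
    rw [hformula]
    refine (continuous_apply i).continuousOn.sub (continuousOn_finsetSum _ fun j hj => ?_)
    have hj' := ih j (Finset.mem_Iio.1 hj)
    refine ContinuousOn.smul (ContinuousOn.div
      (hj'.inner (𝕜 := ℂ) (continuous_apply i).continuousOn)
      ((Complex.continuous_ofReal.comp_continuousOn hj'.norm).pow 2) fun f hf => ?_) hj'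
    have := InnerProductSpace.gramSchmidt_ne_zero (𝕜 := ℂ) j hf
    simpa using this

theorem continuousOn_gramSchmidtNormed {ι E : Type*} [LinearOrder ι] [LocallyFiniteOrderBot ι]
    [WellFoundedLT ι] [NormedAddCommGroup E] [InnerProductSpace ℂ E] (i : ι) :
    ContinuousOn (fun f : ι → E => InnerProductSpace.gramSchmidtNormed ℂ f i)
      {f | LinearIndependent ℂ f} := by
  have h := continuousOn_gramSchmidt (E := E) i
  refine ContinuousOn.smul (ContinuousOn.inv₀
    (Complex.continuous_ofReal.comp_continuousOn h.norm) fun f hf => ?_) h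
  have := InnerProductSpace.gramSchmidt_ne_zero (𝕜 := ℂ) i hf
  simpa using this

theorem InnerProductSpace.gramSchmidtNormed_of_orthonormal {ι E : Type*} [LinearOrder ι]
    [LocallyFiniteOrderBot ι] [WellFoundedLT ι] [NormedAddCommGroup E] [InnerProductSpace ℂ E]
    {f : ι → E} (hf : Orthonormal ℂ f) : gramSchmidtNormed ℂ f = f := by
  funext i
  rw [gramSchmidtNormed, gramSchmidt_of_orthogonal ℂ fun i j hij => hf.2 hij, hf.1 i]
  simp

/-- The columns of a matrix, listed through an enumeration `e` of their indices. -/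
def Matrix.euclideanCols {n κ : Type*} (e : n ≃ κ) (M : Matrix n n ℂ) (k : κ) :
    EuclideanSpace ℂ n :=
  WithLp.toLp 2 fun i => M i (e.symm k)

theorem Matrix.orthonormal_euclideanCols_iff {n κ : Type*} [Fintype n] [DecidableEq n]
    (e : n ≃ κ) (M : Matrix n n ℂ) :
    Orthonormal ℂ (M.euclideanCols e) ↔ M ∈ Matrix.unitaryGroup n ℂ := by
  classical
  rw [Matrix.mem_unitaryGroup_iff', orthonormal_iff_ite, ← Matrix.ext_iff]
  have hentry : ∀ i j, (star M * M) i j =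
      inner ℂ (M.euclideanCols e (e i)) (M.euclideanCols e (e j)) := by
    intro i j
    simp [Matrix.euclideanCols, EuclideanSpace.inner_eq_star_dotProduct, Matrix.mul_apply,
      dotProduct, Matrix.star_apply, mul_comm]
  constructor
  · intro h i j
    rw [hentry, h, Matrix.one_apply]
    simp
  · intro h i j
    have := h (e.symm i) (e.symm j)
    rw [hentry, Matrix.one_apply] at this
    simpa using this

theorem Matrix.linearIndependent_euclideanCols {n κ : Type*} [Fintype n] [DecidableEq n]
    (e : n ≃ κ) {M : Matrix n n ℂ} (hM : M.det ≠ 0) :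
    LinearIndependent ℂ (M.euclideanCols e) := by
  have h := Matrix.linearIndependent_cols_iff_isUnit.2
    ((Matrix.isUnit_iff_isUnit_det M).2 (isUnit_iff_ne_zero.2 hM))
  exact (h.comp e.symm e.symm.injective).map' (WithLp.linearEquiv 2 ℂ (n → ℂ)).symm.toLinearMap
    (LinearEquiv.ker _)

/-- The Gram-Schmidt process retracts the invertible matrices onto the unitary group, and it only
rescales the first column, which may be any given one. -/
theorem Matrix.exists_retraction_unitaryGroup {n : Type*} [Fintype n] [DecidableEq n] (i₀ : n) :
    ∃ g : Matrix n n ℂ → Matrix.unitaryGroup n ℂ, ContinuousOn g {M | M.det ≠ 0} ∧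
      (∀ V : Matrix.unitaryGroup n ℂ, g V = V) ∧
      ∀ M : Matrix n n ℂ, M.det ≠ 0 → ∃ c : ℂ, c ≠ 0 ∧
        ∀ i, (g M : Matrix n n ℂ) i i₀ = c * M i i₀ := by
  classical
  have : Nonempty n := ⟨i₀⟩
  -- The swap puts `i₀` first, so that Gram-Schmidt only normalizes that column.
  let e : n ≃ Fin (Fintype.card n) := (Fintype.equivFin n).trans
    (Equiv.swap (Fintype.equivFin n i₀) ⟨0, Fintype.card_pos⟩)
  have he : e i₀ = ⟨0, Fintype.card_pos⟩ := by simp [e]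
  let G : Matrix n n ℂ → Matrix n n ℂ := fun M => Matrix.of fun i j =>
    InnerProductSpace.gramSchmidtNormed ℂ (M.euclideanCols e) (e j) i
  have hGcols : ∀ M, (G M).euclideanCols e =
      InnerProductSpace.gramSchmidtNormed ℂ (M.euclideanCols e) := by
    intro M
    funext k
    ext i
    simp [G, Matrix.euclideanCols]
  have hG : ∀ M : Matrix n n ℂ, M.det ≠ 0 → G M ∈ Matrix.unitaryGroup n ℂ := by
    intro M hM
    rw [← Matrix.orthonormal_euclideanCols_iff e, hGcols]
    exact InnerProductSpace.gramSchmidtNormed_orthonormal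
      (Matrix.linearIndependent_euclideanCols e hM)
  have hGcont : ContinuousOn G {M | M.det ≠ 0} := by
    refine continuousOn_pi.2 fun i => continuousOn_pi.2 fun j => ?_
    have hcols : Continuous fun M : Matrix n n ℂ => M.euclideanCols e :=
      continuous_pi fun k => (PiLp.continuous_toLp 2 _).comp
        (continuous_pi fun i => continuous_id.matrix_elem i (e.symm k))
    have h := (continuousOn_gramSchmidtNormed (E := EuclideanSpace ℂ n) (e j)).comp
      hcols.continuousOn fun M (hM : M.det ≠ 0) => Matrix.linearIndependent_euclideanCols e hM
    exact (EuclideanSpace.proj (𝕜 := ℂ) i).continuous.comp_continuousOn h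
  have hVdet : ∀ V : Matrix.unitaryGroup n ℂ, (V : Matrix n n ℂ).det ≠ 0 := fun V =>
    (Matrix.UnitaryGroup.det_isUnit V).ne_zero
  -- The value 1 on singular matrices is arbitrary.
  refine ⟨fun M => if h : M.det ≠ 0 then ⟨G M, hG M h⟩ else 1, ?_, fun V => ?_, fun M hM => ?_⟩
  · rw [Topology.IsInducing.subtypeVal.continuousOn_iff]
    refine hGcont.congr fun M (hM : M.det ≠ 0) => ?_
    simp [hM]
  · have hcols := hGcols (V : Matrix n n ℂ)
    rw [InnerProductSpace.gramSchmidtNormed_of_orthonormal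
      ((Matrix.orthonormal_euclideanCols_iff e _).2 V.2)] at hcols
    refine (dif_pos (hVdet V)).trans ?_
    ext i j
    have := congrArg (fun v : EuclideanSpace ℂ n => v i) (congrFun hcols (e j))
    simpa [Matrix.euclideanCols] using this
  · have hempty : Finset.Iio (e i₀) = ∅ := by
      rw [he]; ext k; simp
    have hgs : InnerProductSpace.gramSchmidt ℂ (M.euclideanCols e) (e i₀) =
        M.euclideanCols e (e i₀) := by
      rw [InnerProductSpace.gramSchmidt_def, hempty]; simp
    have hne := InnerProductSpace.gramSchmidt_ne_zero (𝕜 := ℂ) (e i₀)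
      (Matrix.linearIndependent_euclideanCols e hM)
    refine ⟨(‖InnerProductSpace.gramSchmidt ℂ (M.euclideanCols e) (e i₀)‖ : ℂ)⁻¹, by simpa using hne,
      fun i => ?_⟩
    refine (congrArg (fun U : Matrix.unitaryGroup n ℂ => (U : Matrix n n ℂ) i i₀)
      (dif_pos hM)).trans ?_
    simp [G, InnerProductSpace.gramSchmidtNormed, hgs, Matrix.euclideanCols]

/-- The unitary matrices at which a homogeneous polynomial function `q` of a given column does not
vanish form a connected dense subset of the unitary group. -/
theorem Matrix.unitaryGroup_isConnected_and_dense_col_ne_zero {n : Type*} [Fintype n]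
    [DecidableEq n] (i₀ : n) {q : (n → ℂ) → ℂ} {k : ℕ}
    (hhom : ∀ (c : ℂ) ψ, q (c • ψ) = c ^ k * q ψ)
    (hq : ∀ a b : n → ℂ, ∃ p : Polynomial ℂ, ∀ z : ℂ, q (a + z • b) = p.eval z)
    (hne : ∃ ψ, q ψ ≠ 0) :
    IsConnected {V : Matrix.unitaryGroup n ℂ | q (fun i => (V : Matrix n n ℂ) i i₀) ≠ 0} ∧
      Dense {V : Matrix.unitaryGroup n ℂ | q (fun i => (V : Matrix n n ℂ) i i₀) ≠ 0} := by
  obtain ⟨g, hgc, hgV, hgM⟩ := Matrix.exists_retraction_unitaryGroup i₀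
  have hqcol : ∀ A B : Matrix n n ℂ, ∃ p : Polynomial ℂ, ∀ z : ℂ,
      q (fun i => (A + z • B) i i₀) = p.eval z := fun A B =>
    hq (fun i => A i i₀) (fun i => B i i₀)
  have hprod : ∀ A B : Matrix n n ℂ, ∃ p : Polynomial ℂ, ∀ z : ℂ,
      (A + z • B).det * q (fun i => (A + z • B) i i₀) = p.eval z := by
    intro A B
    obtain ⟨p, hp⟩ := Matrix.exists_polynomial_det_add_smul A B
    obtain ⟨r, hr⟩ := hqcol A B
    exact ⟨p * r, fun z => by rw [hp, hr, Polynomial.eval_mul]⟩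
  have hex : ∃ M : Matrix n n ℂ, M.det * q (fun i => M i i₀) ≠ 0 := by
    obtain ⟨ψ, hψ⟩ := hne
    -- The two factors need separate witnesses only: the identity for `det`, and for `q` the matrix
    -- whose columns all equal `ψ`.
    exact exists_mul_ne_zero_of_polynomial_on_lines Matrix.exists_polynomial_det_add_smul hqcol
      ⟨1, by simp⟩ ⟨Matrix.of fun i _ => ψ i, hψ⟩
  obtain ⟨hconn, hdense⟩ := isConnected_and_dense_ne_zero_of_polynomial_on_lines hprod hex
  have hVdet : ∀ V : Matrix.unitaryGroup n ℂ, (V : Matrix n n ℂ).det ≠ 0 := fun V =>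
    (Matrix.UnitaryGroup.det_isUnit V).ne_zero
  have himage : g '' {M | M.det * q (fun i => M i i₀) ≠ 0} =
      {V : Matrix.unitaryGroup n ℂ | q (fun i => (V : Matrix n n ℂ) i i₀) ≠ 0} := by
    ext V
    constructor
    · rintro ⟨M, hM, rfl⟩
      obtain ⟨c, hc, hcM⟩ := hgM M (left_ne_zero_of_mul hM)
      have hcol : (fun i => (g M : Matrix n n ℂ) i i₀) = c • fun i => M i i₀ := by
        funext i
        simp [hcM]
      rw [Set.mem_ofPred_eq, hcol, hhom]
      exact mul_ne_zero (pow_ne_zero _ hc) (right_ne_zero_of_mul hM)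
    · intro hV
      exact ⟨V, mul_ne_zero (hVdet V) hV, hgV V⟩
  rw [← himage]
  refine ⟨hconn.image g (hgc.mono fun M hM => left_ne_zero_of_mul hM), fun V => ?_⟩
  have hopen : IsOpen {M : Matrix n n ℂ | M.det ≠ 0} :=
    isOpen_ne_fun (continuous_id.matrix_det) continuous_const
  have hcontAt : ContinuousAt g (V : Matrix n n ℂ) :=
    hgc.continuousAt (hopen.mem_nhds (hVdet V))
  have := mem_closure_image hcontAt (hdense (V : Matrix n n ℂ))
  rwa [hgV] at this

/-! ### Closed submonoids of compact groups and Haar measure -/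

instance Matrix.unitaryGroup.instCompactSpace {n : Type*} [Fintype n] [DecidableEq n] :
    CompactSpace (Matrix.unitaryGroup n ℂ) := by
  refine (isCompact_iff_compactSpace (s := (unitary (Matrix n n ℂ) : Set (Matrix n n ℂ)))).1 ?_
  have hK : IsCompact (Set.univ.pi fun _ : n => Set.univ.pi fun _ : n =>
      Metric.closedBall (0 : ℂ) 1) :=
    isCompact_univ_pi fun _ => isCompact_univ_pi fun _ => isCompact_closedBall 0 1
  refine IsCompact.of_isClosed_subset (X := n → n → ℂ) hK (isClosed_unitary (R := Matrix n n ℂ))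
    fun V hV => ?_
  simp only [Set.mem_pi, Set.mem_univ, true_implies, mem_closedBall_zero_iff]
  exact entry_norm_bound_of_unitary hV

instance Matrix.unitaryGroup.instSecondCountableTopology {n : Type*} [Fintype n] [DecidableEq n] :
    SecondCountableTopology (Matrix.unitaryGroup n ℂ) :=
  haveI : SecondCountableTopology (Matrix n n ℂ) :=
    inferInstanceAs (SecondCountableTopology (n → n → ℂ))
  TopologicalSpace.Subtype.secondCountableTopology
    (unitary (Matrix n n ℂ) : Set (Matrix n n ℂ))

/-- A closed submonoid of a compact group is closed under inversion. -/
theorem Submonoid.inv_mem_of_isClosed {G : Type*} [Group G] [TopologicalSpace G] [CompactSpace G]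
    [IsTopologicalGroup G] (S : Submonoid G) (hS : IsClosed (S : Set G)) {x : G} (hx : x ∈ S) :
    x⁻¹ ∈ S := by
  -- By compactness, `x⁻¹` is a cluster point of the powers of `x`.
  have h := mapClusterPt_inv_atTop_pow.2 (mapClusterPt_self_atTop_pow x)
  exact hS.mem_of_mapClusterPt h (Filter.Eventually.of_forall fun n => S.pow_mem hx n)

/-- A closed submonoid with dense complement in a second countable compact group is a null set for
Haar measure. -/
theorem Submonoid.haar_eq_zero_of_dense_compl {G : Type*} [Group G] [TopologicalSpace G]
    [CompactSpace G] [T2Space G] [SecondCountableTopology G] [IsTopologicalGroup G]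
    [MeasurableSpace G] [BorelSpace G] (μ : MeasureTheory.Measure G) [μ.IsHaarMeasure]
    (S : Submonoid G) (hS : IsClosed (S : Set G)) (hd : Dense (S : Set G)ᶜ) :
    μ (S : Set G) = 0 := by
  by_contra hpos
  -- Steinhaus: `S / S` is a neighbourhood of 1.
  have hnhds := MeasureTheory.Measure.div_mem_nhds_one_of_haar_pos_ne_top μ (S : Set G)
    hS.measurableSet (pos_iff_ne_zero.2 hpos) hS.isCompact.measure_ne_top
  obtain ⟨x, hx, hxS⟩ := hd.inter_nhds_nonempty hnhds
  obtain ⟨a, ha, b, hb, rfl⟩ := Set.mem_div.1 hxS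
  refine hx ?_
  rw [div_eq_mul_inv]
  exact S.mul_mem ha (S.inv_mem_of_isClosed hS hb)

/-! ### Primitive and imprimitive gates -/

theorem continuous_tensorKet {d : ℕ} :
    Continuous fun p : EuclideanSpace ℂ (Fin d) × EuclideanSpace ℂ (Fin d) =>
      tensorKet p.1 p.2 := by
  refine (PiLp.continuous_toLp 2 _).comp (continuous_pi fun i => ?_)
  exact ((EuclideanSpace.proj (𝕜 := ℂ) i.1).continuous.comp continuous_fst).mul
    ((EuclideanSpace.proj (𝕜 := ℂ) i.2).continuous.comp continuous_snd)

theorem TwoQuditGate.continuous_act {d : ℕ} (ψ : EuclideanSpace ℂ (Fin d × Fin d)) :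
    Continuous fun V : TwoQuditGate d => V.act ψ :=
  (PiLp.continuous_toLp 2 _).comp (continuous_subtype_val.matrix_mulVec continuous_const)

theorem TwoQuditGate.one_act {d : ℕ} (ψ : EuclideanSpace ℂ (Fin d × Fin d)) :
    (1 : TwoQuditGate d).act ψ = ψ := by
  simp [TwoQuditGate.act]

theorem TwoQuditGate.mul_act {d : ℕ} (V W : TwoQuditGate d)
    (ψ : EuclideanSpace ℂ (Fin d × Fin d)) : (V * W).act ψ = V.act (W.act ψ) := by
  simp [TwoQuditGate.act, Matrix.mulVec_mulVec]

/-- The primitive gates form a monoid. -/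
def primitiveGates (d : ℕ) : Submonoid (TwoQuditGate d) where
  carrier := {V | IsPrimitiveGate V}
  one_mem' := fun x y hx hy => ⟨x, y, hx, hy, TwoQuditGate.one_act _⟩
  mul_mem' := by
    intro V W hV hW x y hx hy
    obtain ⟨u, v, hu, hv, h⟩ := hW x y hx hy
    obtain ⟨s, t, hs, ht, h'⟩ := hV u v hu hv
    exact ⟨s, t, hs, ht, by rw [TwoQuditGate.mul_act, h, h']⟩

theorem isClosed_primitiveGates (d : ℕ) : IsClosed (primitiveGates d : Set (TwoQuditGate d)) := by
  let K : Set (EuclideanSpace ℂ (Fin d × Fin d)) := (fun p : EuclideanSpace ℂ (Fin d) ×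
    EuclideanSpace ℂ (Fin d) => tensorKet p.1 p.2) '' (Metric.sphere 0 1 ×ˢ Metric.sphere 0 1)
  have hK : IsClosed K :=
    (((isCompact_sphere _ _).prod (isCompact_sphere _ _)).image continuous_tensorKet).isClosed
  have heq : (primitiveGates d : Set (TwoQuditGate d)) = ⋂ (x : EuclideanSpace ℂ (Fin d))
      (y : EuclideanSpace ℂ (Fin d)) (_ : IsQudit x) (_ : IsQudit y),
        (fun V : TwoQuditGate d => V.act (tensorKet x y)) ⁻¹' K := by
    ext V
    simp only [Set.mem_iInter]
    refine forall₄_congr fun x y _ _ => ⟨?_, ?_⟩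
    · rintro ⟨u, v, hu, hv, h⟩
      exact ⟨(u, v), ⟨mem_sphere_zero_iff_norm.2 hu, mem_sphere_zero_iff_norm.2 hv⟩, h.symm⟩
    · rintro ⟨⟨u, v⟩, ⟨hu, hv⟩, h⟩
      exact ⟨u, v, mem_sphere_zero_iff_norm.1 hu, mem_sphere_zero_iff_norm.1 hv, h.symm⟩
  rw [heq]
  exact isClosed_iInter fun x => isClosed_iInter fun y => isClosed_iInter fun _ =>
    isClosed_iInter fun _ => hK.preimage (TwoQuditGate.continuous_act _)

/-- A gate is imprimitive if it maps the basis state `|ii⟩` to a state with a nonzero minor. -/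
theorem isImprimitiveGate_of_minor_ne_zero {d : ℕ} (i j : Fin d) (V : TwoQuditGate d)
    (hV : V.1 (i, i) (i, i) * V.1 (j, j) (i, i) - V.1 (i, j) (i, i) * V.1 (j, i) (i, i) ≠ 0) :
    IsImprimitiveGate V := by
  intro hprim
  have hi : IsQudit (EuclideanSpace.single i (1 : ℂ)) := by simp [IsQudit]
  obtain ⟨u, v, -, -, h⟩ := hprim _ _ hi hi
  have hket : tensorKet (EuclideanSpace.single i (1 : ℂ)) (EuclideanSpace.single i 1) =
      EuclideanSpace.single (i, i) 1 := by
    ext p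
    rcases p with ⟨a, b⟩
    by_cases ha : a = i <;> by_cases hb : b = i <;> simp [tensorKet, ha, hb]
  rw [hket] at h
  have hentry : ∀ p : Fin d × Fin d, V.1 p (i, i) = u p.1 * v p.2 := by
    intro p
    have := congrArg (fun ψ : EuclideanSpace ℂ (Fin d × Fin d) => ψ p) h
    simpa [TwoQuditGate.act, tensorKet] using this
  refine hV ?_
  simp only [hentry]
  ring

theorem mainTheorem3 (d : ℕ) (hd : 2 ≤ d) :
    (∀ (_ : MeasurableSpace (TwoQuditGate d)) (_ : BorelSpace (TwoQuditGate d))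
      (μ : MeasureTheory.Measure (TwoQuditGate d)), μ.IsHaarMeasure →
        ∀ᵐ V ∂μ, IsImprimitiveGate V) ∧
    IsConnected {V : TwoQuditGate d | IsImprimitiveGate V} ∧
    IsOpen {V : TwoQuditGate d | IsImprimitiveGate V} ∧
    Dense {V : TwoQuditGate d | IsImprimitiveGate V} := by
  let i : Fin d := ⟨0, by omega⟩
  let j : Fin d := ⟨1, by omega⟩
  have hij : i ≠ j := by simp [i, j, Fin.ext_iff]
  obtain ⟨hconn, hdense⟩ := Matrix.unitaryGroup_isConnected_and_dense_col_ne_zero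
    (n := Fin d × Fin d) (i, i)
    (q := fun ψ => ψ (i, i) * ψ (j, j) - ψ (i, j) * ψ (j, i)) (k := 2)
    (fun c ψ => by simp only [Pi.smul_apply, smul_eq_mul]; ring)
    (fun a b => ⟨(Polynomial.C (a (i, i)) + Polynomial.X * Polynomial.C (b (i, i))) *
        (Polynomial.C (a (j, j)) + Polynomial.X * Polynomial.C (b (j, j))) -
        (Polynomial.C (a (i, j)) + Polynomial.X * Polynomial.C (b (i, j))) *
        (Polynomial.C (a (j, i)) + Polynomial.X * Polynomial.C (b (j, i))), fun z => by
          simp [mul_comm z]⟩)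
    -- The unnormalized maximally entangled vector, whose minor is 1.
    ⟨fun p => if p.1 = p.2 then 1 else 0, by simp [hij]⟩
  have hsub : {V : TwoQuditGate d | V.1 (i, i) (i, i) * V.1 (j, j) (i, i) -
      V.1 (i, j) (i, i) * V.1 (j, i) (i, i) ≠ 0} ⊆ {V | IsImprimitiveGate V} :=
    fun V hV => isImprimitiveGate_of_minor_ne_zero i j V hV
  have hD : Dense {V : TwoQuditGate d | IsImprimitiveGate V} := hdense.mono hsub
  refine ⟨fun _ _ μ _ => ?_, hconn.subset_closure hsub fun V _ => hdense V,
    (isClosed_primitiveGates d).isOpen_compl, hD⟩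
  have hzero := Submonoid.haar_eq_zero_of_dense_compl μ (primitiveGates d)
    (isClosed_primitiveGates d) hD
  rw [MeasureTheory.ae_iff]
  convert hzero using 2
  ext V
  exact not_not
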